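/- Let $E$ be a real Banach lattice. Equip the group of invertible bounded operators on $E$ and all its subsets with the strong operator topology. Let $\mathrm{IAut}^+(E)$ be the group of isometric lattice automorphisms of $E$, let $\mathrm{ZAut}^+(E)$ be the set of central lattice automorphisms, i.e. of those lattice automorphisms $m$ of $E$ for which $-\lambda I\le m\le \lambda I$ for some $\lambda\ge 0$, and let $\mathrm{ZAut}^+(E)\cdot \mathrm{IAut}^+(E)$ be the set of all products $m\phi$ with $m\in \mathrm{ZAut}^+(E)$ and $\phi\in \mathrm{IAut}^+(E)$; in such a product $m$ and $\phi$ are uniquely determined by $m\phi$. Assume that for every compact group $G\subset \mathrm{ZAut}^+(E)\cdot \mathrm{IAut}^+(E)$ the restriction to $G$ of the map $p\colon \mathrm{ZAut}^+(E)\cdot \mathrm{IAut}^+(E)\to \mathrm{IAut}^+(E)$, $m\phi\mapsto\phi$, is continuous. Let $G\subset \mathrm{ZAut}^+(E)\cdot \mathrm{IAut}^+(E)$ be a compact group. Then there is a unique compact group $H\subset \mathrm{IAut}^+(E)$ for which there exists an $m\in \mathrm{ZAut}^+(E)$ with $$G=mHm^{-1}.$$ Conversely, if $H\subset \mathrm{IAut}^+(E)$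 is a compact group and $m\in \mathrm{ZAut}^+(E)$, then $mHm^{-1}$ is a compact subgroup of $\mathrm{ZAut}^+(E)\cdot \mathrm{IAut}^+(E)$. -/

import Mathlib

open scoped Pointwise

/-! Throughout, a real Banach lattice is a complete normed real vector space `E` with a lattice
order that makes it an ordered vector space and for which the norm is solid. The group `E ≃L[ℝ] E`
of invertible bounded operators has composition as its multiplication. -/

namespace BanachLattice

noncomputable section

section Topology

variable (E : Type*) [NormedAddCommGroup E] [NormedSpace ℝ E]

/-- The strong operator topology on the group of invertible bounded operators: the topology induced
by the topology of pointwise convergence on the space of bounded operators. -/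
instance strongOperatorTopology : TopologicalSpace (E ≃L[ℝ] E) :=
  TopologicalSpace.induced
    (fun T => ContinuousLinearMap.toPointwiseConvergenceCLM ℝ (RingHom.id ℝ) E E (T : E →L[ℝ] E))
    inferInstance

end Topology

variable (E : Type*) [NormedAddCommGroup E] [NormedSpace ℝ E] [Lattice E]

/-- The group of lattice automorphisms of `E`. -/
def latticeAut : Subgroup (E ≃L[ℝ] E) where
  carrier := {T | ∀ x y : E, T (x ⊔ y) = T x ⊔ T y ∧ T (x ⊓ y) = T x ⊓ T y}
  mul_mem' := by
    intro S T hS hT x y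
    constructor
    · change S (T (x ⊔ y)) = S (T x) ⊔ S (T y)
      rw [(hT x y).1, (hS _ _).1]
    · change S (T (x ⊓ y)) = S (T x) ⊓ S (T y)
      rw [(hT x y).2, (hS _ _).2]
  one_mem' := fun x y => ⟨rfl, rfl⟩
  inv_mem' := by
    intro T hT x y
    constructor
    · apply T.injective
      rw [(hT _ _).1]
      change T (T.symm _) = T (T.symm _) ⊔ T (T.symm _)
      simp
    · apply T.injective
      rw [(hT _ _).2]
      change T (T.symm _) = T (T.symm _) ⊓ T (T.symm _)
      simp

/-- The group of isometric lattice automorphisms of `E`. -/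
def isometricLatticeAut : Subgroup (E ≃L[ℝ] E) where
  carrier := {T | T ∈ latticeAut E ∧ ∀ x : E, ‖T x‖ = ‖x‖}
  mul_mem' := by
    rintro S T ⟨hS, hS'⟩ ⟨hT, hT'⟩
    exact ⟨mul_mem hS hT, fun x => (hS' (T x)).trans (hT' x)⟩
  one_mem' := ⟨one_mem _, fun x => rfl⟩
  inv_mem' := by
    rintro T ⟨hT, hT'⟩
    refine ⟨inv_mem hT, fun x => ?_⟩
    rw [← hT']
    change ‖T (T.symm x)‖ = ‖x‖
    simp

variable {E} in
/-- An operator `m` is central if `-c I ≤ m ≤ c I` for some `c ≥ 0`. (Such an `m` is automatically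
regular, being the difference of the positive operators `m + c I` and `c I`.) -/
def IsCentral (m : E →L[ℝ] E) : Prop :=
  ∃ c : ℝ, 0 ≤ c ∧ ∀ x : E, 0 ≤ x → -(c • x) ≤ m x ∧ m x ≤ c • x

/-- The set of central lattice automorphisms of `E`. -/
def centralLatticeAut : Set (E ≃L[ℝ] E) :=
  {m | m ∈ latticeAut E ∧ IsCentral (m : E →L[ℝ] E)}

/-- The set of all products `m φ` with `m` a central and `φ` an isometric lattice automorphism. -/
def centralMulIsometric : Set (E ≃L[ℝ] E) :=
  centralLatticeAut E * (isometricLatticeAut E : Set (E ≃L[ℝ] E))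

variable {E} in
theorem exists_isometric_factor (T : centralMulIsometric E) :
    ∃ φ : isometricLatticeAut E, ∃ m ∈ centralLatticeAut E, m * (φ : E ≃L[ℝ] E) = T := by
  obtain ⟨m, hm, φ, hφ, h⟩ := Set.mem_mul.1 T.2
  exact ⟨⟨φ, hφ⟩, m, hm, h⟩

variable {E} in
/-- The map `m φ ↦ φ`. In a Banach lattice the factorization of an operator as a product of a
central and an isometric lattice automorphism is unique (the identity is the only central isometric
lattice automorphism), so that the choice made here is the only one possible. -/
def isometricPart (T : centralMulIsometric E) : isometricLatticeAut E :=
  (exists_isometric_factor T).choose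

/-- The assumption on `E` that the map `m φ ↦ φ` is continuous for the strong operator topologies
when restricted to any compact group that consists of products `m φ`. -/
def ContinuousIsometricPart : Prop :=
  ∀ (G : Subgroup (E ≃L[ℝ] E)) (hG : (G : Set (E ≃L[ℝ] E)) ⊆ centralMulIsometric E),
    IsCompact (G : Set (E ≃L[ℝ] E)) →
      Continuous fun T : G => isometricPart ⟨(T : E ≃L[ℝ] E), hG T.2⟩

end

end BanachLattice

/-! On a compact group `G` the map `p` is a homomorphism, since lattice automorphisms normalise the
central ones, and `z g = g * (p g)⁻¹` satisfies `g * z h = z (g * h) * p g`. Averaging `z` over Haar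
measure, which the assumed continuity of `p` permits, gives an operator `m` with `g * m = m * p g`
by left invariance. Hence `G = m p(G) m⁻¹`. Conversely `m φ m⁻¹ = m (φ m⁻¹ φ⁻¹) φ` has isometric
part `φ`, which forces `H = p(G)`.

The average must be a central automorphism. Banach–Steinhaus bounds all `z g` and their inverses in
norm, and `le_smul_of_disjointness` turns norm bounds into order bounds. So `m` lies between two
positive multiples of the identity, and a Neumann series inverts it. The same lemma shows that
inverses of central automorphisms are central and that factorizations are unique. -/

namespace BanachLattice

/-! ### Order estimates from disjointness -/

section Order

theorem le_of_le_add_of_disjoint {E : Type*} [AddCommGroup E] [Lattice E] [IsOrderedAddMonoid E]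
    {a b e : E} (ha : 0 ≤ a) (h : e ≤ a + b) (heb : e ⊓ b = 0) : e ≤ a := by
  have h1 : e ≤ e ⊓ b + a := by
    rw [inf_add]
    exact le_inf (le_add_of_nonneg_right ha) (by rwa [add_comm])
  simpa [heb] using h1

theorem inf_eq_zero_of_le {E : Type*} [Zero E] [Lattice E] {a b c d : E} (ha : 0 ≤ a) (hb : 0 ≤ b) (hac : a ≤ c) (hbd : b ≤ d)
    (h : c ⊓ d = 0) : a ⊓ b = 0 :=
  le_antisymm (h ▸ inf_le_inf hac hbd) (le_inf ha hb)

theorem smul_inf_of_pos {E : Type*} [AddCommGroup E] [Module ℝ E] [Lattice E]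
    [IsOrderedModule ℝ E] {c : ℝ} (hc : 0 < c) (x y : E) : c • (x ⊓ y) = c • x ⊓ c • y := by
  refine le_antisymm (le_inf (smul_le_smul_of_nonneg_left inf_le_left hc.le)
    (smul_le_smul_of_nonneg_left inf_le_right hc.le)) ?_
  have : c⁻¹ • (c • x ⊓ c • y) ≤ x ⊓ y := by
    refine le_inf ?_ ?_
    · simpa [smul_smul, hc.ne'] using
        smul_le_smul_of_nonneg_left (inf_le_left : c • x ⊓ c • y ≤ c • x) (inv_pos.2 hc).le
    · simpa [smul_smul, hc.ne'] using
        smul_le_smul_of_nonneg_left (inf_le_right : c • x ⊓ c • y ≤ c • y) (inv_pos.2 hc).le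
  simpa [smul_smul, hc.ne'] using smul_le_smul_of_nonneg_left this hc.le

variable {E : Type*} [NormedAddCommGroup E] [NormedSpace ℝ E] [Lattice E] [IsOrderedAddMonoid E]
  [IsOrderedModule ℝ E] [HasSolidNorm E]

/-- If no multiple of `w` separates `v` from a larger value of `u`, then `u ≤ v`. -/
theorem le_of_disjoint_cuts {u v w : E} (hv : 0 ≤ v) (hvw : v ≤ w) (huw : u ≤ w)
    (h : ∀ t : ℝ, 0 ≤ t → (u - t • w)⁺ ⊓ (t • w - v)⁺ = 0) : u ≤ v := by
  have hw : 0 ≤ w := hv.trans hvw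
  have key : ∀ δ : ℝ, 0 < δ → u - v - δ • w ≤ 0 := by
    intro δ hδ
    set e := (u - v - δ • w)⁺ with he
    have he0 : 0 ≤ e := posPart_nonneg _
    -- Climb in steps of `δ`: if `e` is disjoint from `(kδw - v)⁺`, then `e ≤ (u - (k+1)δw)⁺`, which
    -- `h` makes disjoint from `((k+1)δw - v)⁺`.
    have hind : ∀ k : ℕ, e ⊓ ((k * δ) • w - v)⁺ = 0 := by
      intro k
      induction k with
      | zero =>
        have : ((((0 : ℕ) : ℝ) * δ) • w - v)⁺ = 0 := by simpa using hv
        rw [this]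
        exact inf_eq_right.2 he0
      | succ k ih =>
        have hle : e ≤ (u - (((k + 1 : ℕ) : ℝ) * δ) • w)⁺ + ((k * δ) • w - v)⁺ := by
          refine sup_le ?_ (add_nonneg (posPart_nonneg _) (posPart_nonneg _))
          calc u - v - δ • w = (u - (((k + 1 : ℕ) : ℝ) * δ) • w) + ((k * δ) • w - v) := by
                push_cast; module
            _ ≤ _ := add_le_add (le_posPart _) (le_posPart _)
        have hle' := le_of_le_add_of_disjoint (posPart_nonneg _) hle ih
        exact inf_eq_zero_of_le he0 (posPart_nonneg _) hle' le_rfl (h _ (by positivity))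
    have hew : e ≤ w := by
      refine sup_le ?_ hw
      calc u - v - δ • w ≤ u - 0 - 0 :=
            sub_le_sub (sub_le_sub_left hv u) (smul_nonneg hδ.le hw)
        _ ≤ w := by simpa using huw
    -- Once `kδ ≥ 2`, `kδw - v ≥ 2w - w = w ≥ e`, so `e` is disjoint from an element above it.
    obtain ⟨k, hk⟩ := exists_nat_ge (2 / δ)
    have hk' : 2 ≤ k * δ := (div_le_iff₀ hδ).1 hk
    have hwk : w ≤ ((k * δ) • w - v)⁺ := by
      refine le_trans ?_ (le_posPart _)
      calc w = (2 : ℝ) • w - w := by module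
        _ ≤ _ := sub_le_sub (smul_le_smul_of_nonneg_right hk' hw) hvw
    have : e = 0 := by
      rw [← hind k]
      exact (inf_eq_left.2 (hew.trans hwk)).symm
    exact posPart_eq_zero.1 this
  have hlim : Filter.Tendsto (fun δ : ℝ => u - v - δ • w) (nhdsWithin 0 (Set.Ioi 0))
      (nhds (u - v - (0 : ℝ) • w)) :=
    ((by fun_prop : Continuous fun δ : ℝ => u - v - δ • w).tendsto 0).mono_left nhdsWithin_le_nhds
  have := le_of_tendsto hlim (Filter.eventually_of_mem self_mem_nhdsWithin fun δ hδ => key δ hδ)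
  simpa using this

variable [CompleteSpace E]

/-- A contractive lattice homomorphism that preserves bands is dominated by the identity. -/
theorem le_self_of_disjointness {N : E →L[ℝ] E} (hN : ‖N‖ < 1)
    (hsup : ∀ x y, N (x ⊔ y) = N x ⊔ N y) (hdis : ∀ x y, x ⊓ y = 0 → N x ⊓ y = 0)
    {v : E} (hv : 0 ≤ v) : N v ≤ v := by
  have hmono : ∀ x y, x ≤ y → N x ≤ N y := fun x y hxy => by
    rw [← sup_eq_right, ← hsup, sup_eq_right.2 hxy]
  have hpow : ∀ k : ℕ, 0 ≤ (N ^ k) v := by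
    intro k
    induction k with
    | zero => simpa using hv
    | succ k ih =>
      rw [pow_succ']
      simpa using hmono _ _ ih
  have hsum : Summable fun k : ℕ => (N ^ k) v :=
    ((summable_geometric_of_norm_lt_one hN).hasSum.mapL
      (ContinuousLinearMap.apply ℝ E v)).summable
  -- The Neumann sum is a majorant of `v` with `N w ≤ w`, so that `(N v - t w)⁺ ≤ N (v - t w)⁺`.
  set w := ∑' k : ℕ, (N ^ k) v with hw
  have hwN : w = v + N w := by
    rw [hw, N.map_tsum hsum]
    conv_lhs => rw [hsum.tsum_eq_zero_add]
    simp [pow_succ']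
  have hw0 : 0 ≤ w := tsum_nonneg hpow
  have hNw : N w ≤ w := by
    conv_rhs => rw [hwN]
    exact le_add_of_nonneg_left hv
  have hvw : v ≤ w := by
    rw [hwN]
    exact le_add_of_nonneg_right (by simpa using hmono _ _ hw0)
  refine le_of_disjoint_cuts hv hvw ((hmono _ _ hvw).trans hNw) fun t ht => ?_
  have h1 : (v - t • w)⁺ ⊓ (t • w - v)⁺ = 0 := by
    rw [← neg_sub v (t • w), posPart_neg]
    exact posPart_inf_negPart_eq_zero _
  refine inf_eq_zero_of_le (posPart_nonneg _) (posPart_nonneg _) ?_ le_rfl (hdis _ _ h1)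
  rw [posPart_def, posPart_def, hsup, map_zero, map_sub, map_smul]
  exact sup_le_sup_right (sub_le_sub_left (smul_le_smul_of_nonneg_left hNw ht) _) _

end Order

/-! ### Central automorphisms and unique factorization -/

section Central

variable {E : Type*} [NormedAddCommGroup E] [NormedSpace ℝ E] [Lattice E]

theorem apply_inv_apply {E : Type*} [NormedAddCommGroup E] [NormedSpace ℝ E] (T : E ≃L[ℝ] E)
    (x : E) : T (T⁻¹ x) = x :=
  T.apply_symm_apply x

theorem monotone_of_mem_latticeAut {T : E ≃L[ℝ] E} (hT : T ∈ latticeAut E) : Monotone T :=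
  fun x y hxy => by rw [← sup_eq_right, ← (hT x y).1, sup_eq_right.2 hxy]

theorem map_nonneg_of_mem_latticeAut {T : E ≃L[ℝ] E} (hT : T ∈ latticeAut E) {x : E}
    (hx : 0 ≤ x) : 0 ≤ T x := by
  simpa using monotone_of_mem_latticeAut hT hx

theorem mul_isometricPart_inv_mem (T : centralMulIsometric E) :
    (T : E ≃L[ℝ] E) * (isometricPart T : E ≃L[ℝ] E)⁻¹ ∈ centralLatticeAut E := by
  obtain ⟨n, hn, hn'⟩ := (exists_isometric_factor T).choose_spec
  rw [← hn']
  convert hn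
  exact mul_inv_cancel_right _ _

variable [IsOrderedAddMonoid E] [IsOrderedModule ℝ E]

theorem disjointness_of_le_smul {T : E →L[ℝ] E}
    {c : ℝ} (h0 : ∀ x, 0 ≤ x → 0 ≤ T x) (hc : ∀ x, 0 ≤ x → T x ≤ c • x) {x y : E}
    (h : x ⊓ y = 0) : T x ⊓ y = 0 := by
  have hx : 0 ≤ x := h ▸ inf_le_left
  have hy : 0 ≤ y := h ▸ inf_le_right
  -- The factor `max c 1` makes one scalar dominate both `T x` and `y`.
  have hd : (max c 1) • x ⊓ (max c 1) • y = 0 := by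
    rw [← smul_inf_of_pos (by positivity), h, smul_zero]
  refine inf_eq_zero_of_le (h0 x hx) hy
    ((hc x hx).trans (smul_le_smul_of_nonneg_right (le_max_left _ _) hx)) ?_ hd
  simpa using smul_le_smul_of_nonneg_right (le_max_right c 1) hy

theorem mem_centralLatticeAut_iff {m : E ≃L[ℝ] E} :
    m ∈ centralLatticeAut E ↔ m ∈ latticeAut E ∧ ∃ c : ℝ, 0 ≤ c ∧ ∀ x, 0 ≤ x → m x ≤ c • x := by
  refine and_congr_right fun hm => ⟨fun ⟨c, hc, h⟩ => ⟨c, hc, fun x hx => (h x hx).2⟩,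
    fun ⟨c, hc, h⟩ => ⟨c, hc, fun x hx => ⟨?_, h x hx⟩⟩⟩
  exact (neg_nonpos.2 (smul_nonneg hc hx)).trans (map_nonneg_of_mem_latticeAut hm hx)

theorem disjointness_of_mem {m : E ≃L[ℝ] E}
    (hm : m ∈ centralLatticeAut E) {x y : E} (h : x ⊓ y = 0) : m x ⊓ y = 0 := by
  obtain ⟨hm, c, -, hc⟩ := mem_centralLatticeAut_iff.1 hm
  exact disjointness_of_le_smul (T := (m : E →L[ℝ] E))
    (fun x => map_nonneg_of_mem_latticeAut hm) hc h

/-- `m⁻¹ x` and `m⁻¹ y` are disjoint, and applying `m` to the second alone keeps them so. -/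
theorem inv_disjointness_of_mem {m : E ≃L[ℝ] E}
    (hm : m ∈ centralLatticeAut E) {x y : E} (h : x ⊓ y = 0) : m⁻¹ x ⊓ y = 0 := by
  have h1 : m⁻¹ x ⊓ m⁻¹ y = 0 := by
    rw [← ((inv_mem hm.1 : m⁻¹ ∈ latticeAut E) x y).2, h, map_zero]
  have h2 := disjointness_of_mem hm ((inf_comm _ _).trans h1)
  rw [inf_comm]
  rwa [apply_inv_apply] at h2

theorem mul_mem_centralLatticeAut {m n : E ≃L[ℝ] E} (hm : m ∈ centralLatticeAut E)
    (hn : n ∈ centralLatticeAut E) : m * n ∈ centralLatticeAut E := by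
  obtain ⟨hm, c, hc0, hc⟩ := mem_centralLatticeAut_iff.1 hm
  obtain ⟨hn, d, hd0, hd⟩ := mem_centralLatticeAut_iff.1 hn
  refine mem_centralLatticeAut_iff.2 ⟨mul_mem hm hn, c * d, by positivity, fun x hx => ?_⟩
  calc m (n x) ≤ c • n x := hc _ (map_nonneg_of_mem_latticeAut hn hx)
    _ ≤ c • d • x := smul_le_smul_of_nonneg_left (hd x hx) hc0
    _ = (c * d) • x := smul_smul _ _ _

theorem conj_mem_centralLatticeAut {m T : E ≃L[ℝ] E} (hm : m ∈ centralLatticeAut E)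
    (hT : T ∈ latticeAut E) : T * m * T⁻¹ ∈ centralLatticeAut E := by
  obtain ⟨hm, c, hc0, hc⟩ := mem_centralLatticeAut_iff.1 hm
  refine mem_centralLatticeAut_iff.2 ⟨mul_mem (mul_mem hT hm) (inv_mem hT), c, hc0, fun x hx => ?_⟩
  calc T (m (T⁻¹ x)) ≤ T (c • T⁻¹ x) :=
        monotone_of_mem_latticeAut hT (hc _ (map_nonneg_of_mem_latticeAut (inv_mem hT) hx))
    _ = c • x := by
      rw [map_smul, apply_inv_apply]

variable [HasSolidNorm E] [CompleteSpace E]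

/-- `c⁻¹ T` is a contraction that still preserves disjointness. No order bound on `T` is
presupposed, so this applies to inverses of central automorphisms. -/
theorem le_smul_of_disjointness {T : E ≃L[ℝ] E} (hT : T ∈ latticeAut E)
    (hdis : ∀ x y, x ⊓ y = 0 → T x ⊓ y = 0) {c : ℝ} (hc : ‖(T : E →L[ℝ] E)‖ < c) {x : E}
    (hx : 0 ≤ x) : T x ≤ c • x := by
  have hc0 : 0 < c := (norm_nonneg _).trans_lt hc
  have key : (c⁻¹ • (T : E →L[ℝ] E)) x ≤ x := by
    refine le_self_of_disjointness ?_ (fun x y => ?_) (fun x y h => ?_) hx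
    · rw [norm_smul, norm_inv, Real.norm_of_nonneg hc0.le, inv_mul_lt_iff₀ hc0, mul_one]
      exact hc
    · change c⁻¹ • T (x ⊔ y) = c⁻¹ • T x ⊔ c⁻¹ • T y
      have := smul_inf_of_pos (inv_pos.2 hc0) (-(T x)) (-(T y))
      rw [(hT x y).1]
      rw [← neg_sup, smul_neg, smul_neg, smul_neg, ← neg_sup, neg_inj] at this
      exact this
    · have hy : 0 ≤ y := h ▸ inf_le_right
      have hTx : 0 ≤ T x := map_nonneg_of_mem_latticeAut hT (h ▸ inf_le_left)
      have h1 : T x ⊓ c • y = 0 := by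
        have h2 := hdis x y h
        rw [inf_comm] at h2 ⊢
        refine disjointness_of_le_smul (T := c • ContinuousLinearMap.id ℝ E) (c := c)
          (fun z hz => smul_nonneg hc0.le hz) (fun z hz => le_rfl) h2
      have h2 : c⁻¹ • (T x ⊓ c • y) = 0 := by rw [h1, smul_zero]
      rw [smul_inf_of_pos (inv_pos.2 hc0), inv_smul_smul₀ hc0.ne'] at h2
      exact h2
  have := smul_le_smul_of_nonneg_left key hc0.le
  simpa [smul_smul, hc0.ne'] using this

theorem le_smul_of_mem {m : E ≃L[ℝ] E} (hm : m ∈ centralLatticeAut E) {c : ℝ}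
    (hc : ‖(m : E →L[ℝ] E)‖ < c) {x : E} (hx : 0 ≤ x) : m x ≤ c • x :=
  le_smul_of_disjointness hm.1 (fun _ _ => disjointness_of_mem hm) hc hx

theorem inv_mem_centralLatticeAut {m : E ≃L[ℝ] E} (hm : m ∈ centralLatticeAut E) :
    m⁻¹ ∈ centralLatticeAut E :=
  mem_centralLatticeAut_iff.2 ⟨inv_mem hm.1, ‖((m⁻¹ : E ≃L[ℝ] E) : E →L[ℝ] E)‖ + 1, by positivity,
    fun _ hx => le_smul_of_disjointness (inv_mem hm.1) (fun _ _ => inv_disjointness_of_mem hm)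
      (lt_add_one _) hx⟩

theorem le_self_of_mem_of_isometric {m : E ≃L[ℝ] E} (hm : m ∈ centralLatticeAut E)
    (hi : m ∈ isometricLatticeAut E) {x : E} (hx : 0 ≤ x) : m x ≤ x := by
  have hn : ‖(m : E →L[ℝ] E)‖ ≤ 1 :=
    ContinuousLinearMap.opNorm_le_bound _ zero_le_one fun x => by simpa using (hi.2 x).le
  have hlim : Filter.Tendsto (fun c : ℝ => c • x) (nhdsWithin 1 (Set.Ioi 1)) (nhds ((1 : ℝ) • x)) :=
    ((by fun_prop : Continuous fun c : ℝ => c • x).tendsto 1).mono_left nhdsWithin_le_nhds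
  rw [← one_smul ℝ x] at hlim ⊢
  simpa using ge_of_tendsto hlim (Filter.eventually_of_mem self_mem_nhdsWithin fun c hc => by
    simpa using le_smul_of_mem hm (hn.trans_lt hc) hx)

theorem eq_one_of_mem_of_isometric {m : E ≃L[ℝ] E} (hm : m ∈ centralLatticeAut E)
    (hi : m ∈ isometricLatticeAut E) : m = 1 := by
  have hpos : ∀ x : E, 0 ≤ x → m x = x := fun x hx => by
    refine le_antisymm (le_self_of_mem_of_isometric hm hi hx) ?_
    have := monotone_of_mem_latticeAut hm.1
      (le_self_of_mem_of_isometric (inv_mem_centralLatticeAut hm) (inv_mem hi) hx)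
    rwa [apply_inv_apply] at this
  ext x
  rw [← posPart_sub_negPart x, map_sub, hpos _ (posPart_nonneg x), hpos _ (negPart_nonneg x)]
  rfl

theorem isometric_factor_unique {m n φ ψ : E ≃L[ℝ] E} (hm : m ∈ centralLatticeAut E)
    (hn : n ∈ centralLatticeAut E) (hφ : φ ∈ isometricLatticeAut E)
    (hψ : ψ ∈ isometricLatticeAut E) (h : m * φ = n * ψ) : φ = ψ := by
  have h1 : n⁻¹ * m = ψ * φ⁻¹ := by
    rw [inv_mul_eq_iff_eq_mul, ← mul_assoc, ← h, mul_inv_cancel_right]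
  have h2 := eq_one_of_mem_of_isometric
    (h1 ▸ mul_mem_centralLatticeAut (inv_mem_centralLatticeAut hn) hm : ψ * φ⁻¹ ∈ _)
    (mul_mem hψ (inv_mem hφ))
  exact (mul_inv_eq_one.1 h2).symm

theorem isometricPart_eq {m φ : E ≃L[ℝ] E} (hm : m ∈ centralLatticeAut E)
    (hφ : φ ∈ isometricLatticeAut E) (T : centralMulIsometric E) (h : m * φ = T) :
    (isometricPart T : E ≃L[ℝ] E) = φ := by
  obtain ⟨n, hn, hn'⟩ := (exists_isometric_factor T).choose_spec
  exact isometric_factor_unique hn hm (isometricPart T).2 hφ (hn'.trans h.symm)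

/-- `(m φ)(n ψ) = m (φ n φ⁻¹) φ ψ`, with `φ n φ⁻¹` central. -/
theorem isometricPart_mul (S T U : centralMulIsometric E)
    (h : (S : E ≃L[ℝ] E) * (T : E ≃L[ℝ] E) = U) :
    (isometricPart U : E ≃L[ℝ] E) = isometricPart S * isometricPart T := by
  have hS := (isometricPart S).2
  refine isometricPart_eq (mul_mem_centralLatticeAut (mul_isometricPart_inv_mem S)
    (conj_mem_centralLatticeAut (mul_isometricPart_inv_mem T) hS.1))
    (mul_mem hS (isometricPart T).2) U ?_
  rw [← h]
  group

/-- A conjugate of an isometric lattice automorphism by a central one. -/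
theorem conj_mem_centralMulIsometric {m φ : E ≃L[ℝ] E} (hm : m ∈ centralLatticeAut E)
    (hφ : φ ∈ isometricLatticeAut E) :
    ∃ n ∈ centralLatticeAut E, n * φ = m * φ * m⁻¹ :=
  ⟨m * (φ * m⁻¹ * φ⁻¹), mul_mem_centralLatticeAut hm
    (conj_mem_centralLatticeAut (inv_mem_centralLatticeAut hm) hφ.1), by group⟩

end Central

/-! ### Invertibility from two-sided order bounds -/

section Invertible

variable {E : Type*} [NormedAddCommGroup E] [NormedSpace ℝ E] [Lattice E] [IsOrderedAddMonoid E]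

theorem mem_latticeAut_of_disjointness {T : E ≃L[ℝ] E}
    (h : ∀ x y, x ⊓ y = 0 → T x ⊓ T y = 0) : T ∈ latticeAut E := by
  have hdec : ∀ x y : E, x = (x - y)⁺ + x ⊓ y := fun x y => by
    rw [← sub_eq_iff_eq_add, sub_eq_add_neg, neg_inf, add_sup, posPart_def, add_neg_cancel,
      sub_eq_add_neg, sup_comm]
  have hinf : ∀ x y : E, T (x ⊓ y) = T x ⊓ T y := fun x y => by
    have hd : (x - y)⁺ ⊓ (y - x)⁺ = 0 := by
      rw [← neg_sub x y, posPart_neg]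
      exact posPart_inf_negPart_eq_zero _
    have hx : T x = T (x - y)⁺ + T (x ⊓ y) := by rw [← map_add, ← hdec]
    have hy : T y = T (y - x)⁺ + T (x ⊓ y) := by rw [← map_add, inf_comm, ← hdec]
    rw [hx, hy, ← inf_add, h _ _ hd, zero_add]
  intro x y
  refine ⟨?_, hinf x y⟩
  have h1 := congrArg T (inf_add_sup x y)
  rw [map_add, map_add, ← inf_add_sup (T x), hinf] at h1
  exact add_left_cancel h1

variable [HasSolidNorm E]

/-- An operator that is small on the positive cone is small in norm. -/
theorem opNorm_le_of_le_smul {B : E →L[ℝ] E} {r : ℝ} (hr : 0 ≤ r) (h0 : ∀ x, 0 ≤ x → 0 ≤ B x)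
    (h : ∀ x, 0 ≤ x → B x ≤ r • x) : ‖B‖ ≤ r := by
  have hmono : ∀ x y, x ≤ y → B x ≤ B y := fun x y hxy => by
    simpa using h0 _ (sub_nonneg.2 hxy)
  refine B.opNorm_le_bound hr fun x => ?_
  have habs : |B x| ≤ r • |x| := by
    refine abs_le'.2 ⟨(hmono _ _ (le_abs_self x)).trans (h _ (abs_nonneg x)), ?_⟩
    rw [← map_neg]
    exact (hmono _ _ (neg_le_abs x)).trans (h _ (abs_nonneg x))
  calc ‖B x‖ ≤ ‖r • |x|‖ :=
        norm_le_norm_of_abs_le_abs (habs.trans (le_abs_self _))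
    _ = r * ‖x‖ := by rw [norm_smul, norm_abs_eq_norm, Real.norm_of_nonneg hr]

variable [IsOrderedModule ℝ E] [CompleteSpace E]

/-- An operator between two positive multiples of the identity is a central automorphism. -/
theorem exists_mem_centralLatticeAut {A : E →L[ℝ] E} {c δ : ℝ} (hδ : 0 < δ) (hδc : δ ≤ c)
    (hlow : ∀ x, 0 ≤ x → δ • x ≤ A x) (hup : ∀ x, 0 ≤ x → A x ≤ c • x) :
    ∃ m ∈ centralLatticeAut E, (m : E →L[ℝ] E) = A := by
  have hc : 0 < c := hδ.trans_le hδc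
  -- On the cone, `0 ≤ 1 - c⁻¹ A ≤ (1 - c⁻¹ δ) I`, so a Neumann series inverts `c⁻¹ A`.
  have hB : ‖1 - c⁻¹ • A‖ ≤ 1 - c⁻¹ * δ := by
    refine opNorm_le_of_le_smul ?_ (fun x hx => ?_) (fun x hx => ?_)
    · rw [sub_nonneg, inv_mul_le_iff₀ hc, mul_one]
      exact hδc
    · have := smul_le_smul_of_nonneg_left (hup x hx) (inv_pos.2 hc).le
      rw [inv_smul_smul₀ hc.ne'] at this
      simpa using this
    · have := smul_le_smul_of_nonneg_left (hlow x hx) (inv_pos.2 hc).le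
      rw [smul_smul] at this
      rw [sub_smul, one_smul]
      exact sub_le_sub_left this x
  have hB' : ‖1 - c⁻¹ • A‖ < 1 := hB.trans_lt (by
    have : 0 < c⁻¹ * δ := by positivity
    linarith)
  let u : (E →L[ℝ] E)ˣ := Units.mk0 c hc.ne' • Units.oneSub _ hB'
  have hu : (u : E →L[ℝ] E) = A := by
    change c • (1 - (1 - c⁻¹ • A)) = A
    rw [sub_sub_cancel, smul_inv_smul₀ hc.ne']
  have hm : ∀ x, ContinuousLinearEquiv.unitsEquiv ℝ E u x = A x := fun x => by
    rw [ContinuousLinearEquiv.unitsEquiv_apply, hu]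
  have h0 : ∀ x, 0 ≤ x → 0 ≤ A x := fun x hx => (smul_nonneg hδ.le hx).trans (hlow x hx)
  refine ⟨ContinuousLinearEquiv.unitsEquiv ℝ E u, mem_centralLatticeAut_iff.2
    ⟨mem_latticeAut_of_disjointness fun x y h => ?_, c, hc.le, fun x hx => ?_⟩,
    ContinuousLinearMap.ext hm⟩
  · rw [hm, hm]
    have h1 := disjointness_of_le_smul h0 hup h
    rw [inf_comm] at h1 ⊢
    exact disjointness_of_le_smul h0 hup h1
  · rw [hm]
    exact hup x hx

end Invertible

/-! ### Strong operator topology on compact groups -/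

section Topology

variable {E : Type*} [NormedAddCommGroup E] [NormedSpace ℝ E]

theorem continuous_apply_const (x : E) : Continuous fun T : E ≃L[ℝ] E => T x := by
  have h : Continuous fun T : E ≃L[ℝ] E =>
      ContinuousLinearMap.toPointwiseConvergenceCLM ℝ (RingHom.id ℝ) E E (T : E →L[ℝ] E) :=
    continuous_induced_dom
  exact (PointwiseConvergenceCLM.evalCLM (RingHom.id ℝ) E x).continuous.comp h

theorem continuous_of_continuous_apply {X : Type*} [TopologicalSpace X] {f : X → E ≃L[ℝ] E}
    (h : ∀ x, Continuous fun a => f a x) : Continuous f :=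
  continuous_induced_rng.2 (PointwiseConvergenceCLM.continuous_of_continuous_eval h)

theorem continuous_mul_mul_const (S U : E ≃L[ℝ] E) : Continuous fun T : E ≃L[ℝ] E => S * T * U :=
  continuous_of_continuous_apply fun x => S.continuous.comp (continuous_apply_const (U x))

theorem exists_opNorm_le_of_isCompact [CompleteSpace E] {S : Set (E ≃L[ℝ] E)} (hS : IsCompact S) :
    ∃ C : ℝ, ∀ T ∈ S, ‖(T : E →L[ℝ] E)‖ ≤ C := by
  obtain ⟨C, hC⟩ := banach_steinhaus (g := fun T : S => ((T : E ≃L[ℝ] E) : E →L[ℝ] E)) fun x => by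
    obtain ⟨C, hC⟩ := hS.exists_bound_of_continuousOn (continuous_apply_const x).continuousOn
    exact ⟨C, fun T => hC T T.2⟩
  exact ⟨C, fun T hT => hC ⟨T, hT⟩⟩

/-- Evaluation is jointly continuous on norm-bounded families of operators. -/
theorem continuous_apply_of_opNorm_le {X : Type*} [TopologicalSpace X] {f : X → E ≃L[ℝ] E}
    {g : X → E} {C : ℝ} (hC : ∀ a, ‖(f a : E →L[ℝ] E)‖ ≤ C) (hf : Continuous f)
    (hg : Continuous g) : Continuous fun a => f a (g a) := by
  refine continuous_iff_continuousAt.2 fun a => ?_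
  have h1 : Filter.Tendsto (fun b => f b (g a)) (nhds a) (nhds (f a (g a))) :=
    ((continuous_apply_const (g a)).comp hf).tendsto a
  have h2 : Filter.Tendsto (fun b => f b (g b - g a)) (nhds a) (nhds 0) := by
    have h3 : Filter.Tendsto (fun b => C * ‖g b - g a‖) (nhds a) (nhds 0) := by
      have : Continuous fun b => C * ‖g b - g a‖ := by fun_prop
      simpa using this.tendsto a
    exact squeeze_zero_norm
      (fun b => ((f b : E →L[ℝ] E).le_opNorm _).trans
        (mul_le_mul_of_nonneg_right (hC b) (norm_nonneg _))) h3
  simpa [ContinuousAt] using h1.add h2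

theorem isTopologicalGroup_of_isCompact [CompleteSpace E] {G : Subgroup (E ≃L[ℝ] E)}
    (hG : IsCompact (G : Set (E ≃L[ℝ] E))) : IsTopologicalGroup G := by
  obtain ⟨C, hC⟩ := exists_opNorm_le_of_isCompact hG
  have hmul : Continuous fun a : G × G => (a.1 : E ≃L[ℝ] E) * (a.2 : E ≃L[ℝ] E) :=
    continuous_of_continuous_apply fun x =>
      continuous_apply_of_opNorm_le (f := fun a : G × G => (a.1 : E ≃L[ℝ] E))
        (g := fun a : G × G => (a.2 : E ≃L[ℝ] E) x) (fun a => hC _ a.1.2)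
        (continuous_subtype_val.comp continuous_fst)
        ((continuous_apply_const x).comp (continuous_subtype_val.comp continuous_snd))
  have hinv : Continuous fun a : G => (a : E ≃L[ℝ] E)⁻¹ := by
    refine continuous_of_continuous_apply fun x => continuous_iff_continuousAt.2 fun a => ?_
    refine tendsto_iff_norm_sub_tendsto_zero.2 ?_
    set y := (a : E ≃L[ℝ] E)⁻¹ x with hy
    have hx : (a : E ≃L[ℝ] E) y = x := apply_inv_apply _ _
    have hcont : Continuous fun b : G => C * ‖x - (b : E ≃L[ℝ] E) y‖ :=
      continuous_const.mul (continuous_const.sub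
        ((continuous_apply_const y).comp continuous_subtype_val)).norm
    have hlim : Filter.Tendsto (fun b : G => C * ‖x - (b : E ≃L[ℝ] E) y‖) (nhds a) (nhds 0) := by
      simpa [hx] using hcont.tendsto a
    refine squeeze_zero (fun _ => norm_nonneg _) (fun b => ?_) hlim
    -- The inverses also lie in `G`, so `C` bounds them and strong continuity of `b` suffices.
    have hb : (b : E ≃L[ℝ] E)⁻¹ x - y = (b : E ≃L[ℝ] E)⁻¹ (x - (b : E ≃L[ℝ] E) y) := by
      rw [map_sub]
      congr 1
      exact ((b : E ≃L[ℝ] E).symm_apply_apply y).symm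
    rw [hb]
    exact ((((b : E ≃L[ℝ] E)⁻¹ : E ≃L[ℝ] E) : E →L[ℝ] E).le_opNorm _).trans
      (mul_le_mul_of_nonneg_right (hC _ (inv_mem b.2)) (norm_nonneg _))
  exact { continuous_mul := hmul.subtype_mk _, continuous_inv := hinv.subtype_mk _ }

end Topology

/-! ### Haar averaging of the central factors -/

section Average

open MeasureTheory

variable {E : Type*} [NormedAddCommGroup E] [NormedSpace ℝ E]

/-- The mean of a bounded, strongly continuous family of operators. -/
theorem exists_integral_clm {X : Type*} [TopologicalSpace X] [CompactSpace X] [MeasurableSpace X]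
    [BorelSpace X] (μ : Measure X) [IsProbabilityMeasure μ] {f : X → E ≃L[ℝ] E} {C : ℝ}
    (hC : ∀ a, ‖(f a : E →L[ℝ] E)‖ ≤ C) (hint : ∀ x, Integrable (fun a => f a x) μ) :
    ∃ A : E →L[ℝ] E, ∀ x, A x = ∫ a, f a x ∂μ := by
  refine ⟨LinearMap.mkContinuous
    { toFun := fun x => ∫ a, f a x ∂μ
      map_add' := fun x y => by
        simp_rw [map_add]
        exact integral_add (hint x) (hint y)
      map_smul' := fun r x => by
        simp_rw [map_smul]
        exact integral_smul r _ } C fun x => ?_, fun x => rfl⟩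
  simpa using norm_integral_le_of_norm_le_const (μ := μ) (f := fun a => f a x) (C := C * ‖x‖)
    (Filter.Eventually.of_forall fun a => ((f a : E →L[ℝ] E).le_opNorm x).trans
      (mul_le_mul_of_nonneg_right (hC a) (norm_nonneg x)))

theorem opNorm_mul_le_of_isometric {S T : E ≃L[ℝ] E} {C : ℝ} (hC : ‖(S : E →L[ℝ] E)‖ ≤ C)
    (hT : ∀ x, ‖T x‖ = ‖x‖) : ‖((S * T : E ≃L[ℝ] E) : E →L[ℝ] E)‖ ≤ C := by
  refine ContinuousLinearMap.opNorm_le_bound _ ((norm_nonneg _).trans hC) fun x => ?_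
  calc ‖S (T x)‖ ≤ ‖(S : E →L[ℝ] E)‖ * ‖T x‖ := (S : E →L[ℝ] E).le_opNorm _
    _ ≤ C * ‖x‖ := by rw [hT]; exact mul_le_mul_of_nonneg_right hC (norm_nonneg x)

theorem opNorm_isometric_mul_le {S T : E ≃L[ℝ] E} {C : ℝ} (hC : ‖(S : E →L[ℝ] E)‖ ≤ C)
    (hT : ∀ x, ‖T x‖ = ‖x‖) : ‖((T * S : E ≃L[ℝ] E) : E →L[ℝ] E)‖ ≤ C := by
  refine ContinuousLinearMap.opNorm_le_bound _ ((norm_nonneg _).trans hC) fun x => ?_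
  calc ‖T (S x)‖ = ‖S x‖ := hT _
    _ ≤ C * ‖x‖ := (S : E →L[ℝ] E).le_of_opNorm_le hC x

variable [CompleteSpace E] [Lattice E] [IsOrderedAddMonoid E] [IsOrderedModule ℝ E]
  [HasSolidNorm E]

/-- The averaged central factor intertwines a compact group with its isometric parts. -/
theorem exists_intertwiner (hE : ContinuousIsometricPart E) {G : Subgroup (E ≃L[ℝ] E)}
    (hG : (G : Set (E ≃L[ℝ] E)) ⊆ centralMulIsometric E)
    (hGc : IsCompact (G : Set (E ≃L[ℝ] E))) :
    ∃ m ∈ centralLatticeAut E, ∀ g : G,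
      (g : E ≃L[ℝ] E) * m = m * isometricPart ⟨g, hG g.2⟩ := by
  obtain ⟨C, hC⟩ := exists_opNorm_le_of_isCompact hGc
  have := isTopologicalGroup_of_isCompact hGc
  have : CompactSpace G := isCompact_iff_compactSpace.1 hGc
  let _ : MeasurableSpace G := borel G
  have : BorelSpace G := ⟨rfl⟩
  let K : TopologicalSpace.PositiveCompacts G := ⊤
  let μ : Measure G := Measure.haarMeasure K
  have : IsProbabilityMeasure μ := ⟨Measure.haarMeasure_self (K₀ := K)⟩
  let p : G → isometricLatticeAut E := fun g => isometricPart ⟨g, hG g.2⟩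
  have hp : Continuous p := hE G hG hGc
  have hpmul : ∀ g h, p (g * h) = p g * p h := fun g h =>
    Subtype.ext (isometricPart_mul ⟨g, hG g.2⟩ ⟨h, hG h.2⟩ ⟨g * h, hG (g * h).2⟩ rfl)
  have hpinv : ∀ g, p g⁻¹ = (p g)⁻¹ := map_inv (MonoidHom.mk' p hpmul)
  let z : G → E ≃L[ℝ] E := fun g => g * (p g : E ≃L[ℝ] E)⁻¹
  have hz : ∀ g, z g ∈ centralLatticeAut E := fun g => mul_isometricPart_inv_mem ⟨g, hG g.2⟩
  have hzn : ∀ g, ‖(z g : E →L[ℝ] E)‖ ≤ C := fun g =>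
    opNorm_mul_le_of_isometric (hC g g.2) (inv_mem (p g).2).2
  have hzin : ∀ g, ‖(((z g)⁻¹ : E ≃L[ℝ] E) : E →L[ℝ] E)‖ ≤ C := fun g => by
    have : (z g)⁻¹ = (p g : E ≃L[ℝ] E) * (g : E ≃L[ℝ] E)⁻¹ := by simp [z]
    rw [this]
    exact opNorm_isometric_mul_le (hC _ (inv_mem g.2)) (p g).2.2
  have hC0 : 0 ≤ C := (norm_nonneg _).trans (hC 1 (one_mem G))
  have hzc : ∀ x, Continuous fun g => z g x := fun x => by
    refine continuous_apply_of_opNorm_le (f := fun g : G => (g : E ≃L[ℝ] E))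
      (g := fun g => (p g : E ≃L[ℝ] E)⁻¹ x) (fun g => hC g g.2) continuous_subtype_val ?_
    have : ∀ g, (p g : E ≃L[ℝ] E)⁻¹ = (p g⁻¹ : E ≃L[ℝ] E) := fun g => by rw [hpinv]; rfl
    simp_rw [this]
    exact (continuous_apply_const x).comp (continuous_subtype_val.comp (hp.comp continuous_inv))
  have hint : ∀ x, Integrable (fun g => z g x) μ := fun x =>
    (hzc x).integrable_of_hasCompactSupport (HasCompactSupport.of_compactSpace _)
  obtain ⟨A, hA⟩ := exists_integral_clm μ hzn hint
  have hup : ∀ x, 0 ≤ x → A x ≤ (C + 1) • x := fun x hx => by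
    rw [hA]
    refine (integral_mono (hint x) (integrable_const ((C + 1) • x))
      fun g => le_smul_of_mem (hz g) ((hzn g).trans_lt (lt_add_one C)) hx).trans_eq ?_
    simp
  have hlow : ∀ x, 0 ≤ x → (C + 1)⁻¹ • x ≤ A x := fun x hx => by
    rw [hA]
    refine le_trans (le_of_eq ?_) (integral_mono (integrable_const ((C + 1)⁻¹ • x)) (hint x)
      fun g => ?_)
    · simp
    -- The lower bound on `z g` is the upper bound on `(z g)⁻¹`, evaluated at `z g x`.
    have h := le_smul_of_mem (inv_mem_centralLatticeAut (hz g))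
      ((hzin g).trans_lt (lt_add_one C)) (map_nonneg_of_mem_latticeAut (hz g).1 hx)
    have h' : (z g)⁻¹ (z g x) = x := (z g).symm_apply_apply x
    rw [h'] at h
    have := smul_le_smul_of_nonneg_left h (by positivity : 0 ≤ (C + 1)⁻¹)
    rwa [inv_smul_smul₀ (by positivity)] at this
  obtain ⟨m, hm, hmA⟩ := exists_mem_centralLatticeAut (by positivity)
    ((inv_le_one_of_one_le₀ (by linarith)).trans (by linarith)) hlow hup
  refine ⟨m, hm, fun g => ?_⟩
  have hmx : ∀ x, m x = ∫ h, z h x ∂μ := fun x => by rw [← hA, ← hmA]; rfl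
  have hcoc : ∀ h x, (g : E ≃L[ℝ] E) (z h x) = z (g * h) ((p g : E ≃L[ℝ] E) x) := fun h x => by
    have : (g : E ≃L[ℝ] E) * z h = z (g * h) * p g := by
      simp only [z, hpmul]
      push_cast
      group
    exact congrArg (fun T : E ≃L[ℝ] E => T x) this
  ext x
  change (g : E ≃L[ℝ] E) (m x) = m ((p g : E ≃L[ℝ] E) x)
  rw [hmx, hmx, ← integral_mul_left_eq_self (fun h => z h ((p g : E ≃L[ℝ] E) x)) g]
  simp_rw [← hcoc]
  exact ((g : E ≃L[ℝ] E) : E →L[ℝ] E).integral_comp_comm (hint x) |>.symm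

end Average

/-! ### Conjugation and uniqueness of the isometric group -/

section Conjugation

variable {E : Type*} [NormedAddCommGroup E] [NormedSpace ℝ E]

theorem isCompact_map_conj {G : Subgroup (E ≃L[ℝ] E)} (hG : IsCompact (G : Set (E ≃L[ℝ] E)))
    (m : E ≃L[ℝ] E) :
    IsCompact (G.map (MulAut.conj m).toMonoidHom : Set (E ≃L[ℝ] E)) := by
  rw [Subgroup.coe_map]
  exact hG.image (continuous_mul_mul_const m m⁻¹)

variable [CompleteSpace E] [Lattice E] [IsOrderedAddMonoid E] [IsOrderedModule ℝ E]
  [HasSolidNorm E]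

/-- Central conjugation does not change the isometric part, so equal conjugates have the same
isometric parts. -/
theorem le_of_map_conj_eq {H K : Subgroup (E ≃L[ℝ] E)} (hH : H ≤ isometricLatticeAut E)
    (hK : K ≤ isometricLatticeAut E) {m n : E ≃L[ℝ] E} (hm : m ∈ centralLatticeAut E)
    (hn : n ∈ centralLatticeAut E)
    (h : H.map (MulAut.conj m).toMonoidHom = K.map (MulAut.conj n).toMonoidHom) : H ≤ K := by
  intro φ hφ
  have h1 : m * φ * m⁻¹ ∈ K.map (MulAut.conj n).toMonoidHom :=
    h ▸ Subgroup.mem_map_of_mem (MulAut.conj m).toMonoidHom hφ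
  obtain ⟨ψ, hψ, hψ'⟩ := Subgroup.mem_map.1 h1
  obtain ⟨a, ha, ha'⟩ := conj_mem_centralMulIsometric hm (hH hφ)
  obtain ⟨b, hb, hb'⟩ := conj_mem_centralMulIsometric hn (hK hψ)
  rw [isometric_factor_unique ha hb (hH hφ) (hK hψ) (ha'.trans (hψ'.symm.trans hb'.symm))]
  exact hψ

end Conjugation

end BanachLattice

theorem theoremt {E : Type*} [NormedAddCommGroup E] [NormedSpace ℝ E] [CompleteSpace E]
    [Lattice E] [IsOrderedAddMonoid E] [IsOrderedModule ℝ E] [HasSolidNorm E]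
    (hE : BanachLattice.ContinuousIsometricPart E) :
    (∀ G : Subgroup (E ≃L[ℝ] E),
      (G : Set (E ≃L[ℝ] E)) ⊆ BanachLattice.centralMulIsometric E →
      IsCompact (G : Set (E ≃L[ℝ] E)) →
        ∃! H : Subgroup (E ≃L[ℝ] E),
          H ≤ BanachLattice.isometricLatticeAut E ∧
          IsCompact (H : Set (E ≃L[ℝ] E)) ∧
          ∃ m ∈ BanachLattice.centralLatticeAut E, G = H.map (MulAut.conj m).toMonoidHom) ∧
    (∀ H : Subgroup (E ≃L[ℝ] E),
      H ≤ BanachLattice.isometricLatticeAut E →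
      IsCompact (H : Set (E ≃L[ℝ] E)) →
        ∀ m ∈ BanachLattice.centralLatticeAut E,
          (H.map (MulAut.conj m).toMonoidHom : Set (E ≃L[ℝ] E)) ⊆
            BanachLattice.centralMulIsometric E ∧
          IsCompact (H.map (MulAut.conj m).toMonoidHom : Set (E ≃L[ℝ] E))) := by
  refine ⟨fun G hG hGc => ?_, fun H hH hHc m hm => ⟨?_, BanachLattice.isCompact_map_conj hHc m⟩⟩
  · obtain ⟨m, hm, hgm⟩ := BanachLattice.exists_intertwiner hE hG hGc
    have hI : G.map (MulAut.conj m⁻¹).toMonoidHom ≤ BanachLattice.isometricLatticeAut E := by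
      rintro _ ⟨g, hg, rfl⟩
      have h : (MulAut.conj m⁻¹).toMonoidHom g = BanachLattice.isometricPart ⟨g, hG hg⟩ := by
        change m⁻¹ * g * m⁻¹⁻¹ = _
        rw [inv_inv, mul_assoc, hgm ⟨g, hg⟩, inv_mul_cancel_left]
      rw [h]
      exact (BanachLattice.isometricPart _).2
    have hGm : G = (G.map (MulAut.conj m⁻¹).toMonoidHom).map (MulAut.conj m).toMonoidHom := by
      ext g
      simp [Subgroup.mem_map, mul_assoc]
    refine ⟨_, ⟨hI, BanachLattice.isCompact_map_conj hGc _, m, hm, hGm⟩, ?_⟩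
    rintro K ⟨hK, -, n, hn, hKn⟩
    have h := hKn.symm.trans hGm
    exact le_antisymm (BanachLattice.le_of_map_conj_eq hK hI hn hm h)
      (BanachLattice.le_of_map_conj_eq hI hK hm hn h.symm)
  · rintro _ ⟨φ, hφ, rfl⟩
    obtain ⟨n, hn, h⟩ := BanachLattice.conj_mem_centralMulIsometric hm (hH hφ)
    exact Set.mem_mul.2 ⟨n, hn, φ, hH hφ, h⟩
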